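/- For $c>0$ let $\lambda_c(dw)=w^{-1}e^{-cw}\,dw$ on $(0,\infty)$. A gamma process $\Gamma\mathrm P(c,G)$ is $\sum_k w_k\delta_{a_k}$, where the $(w_k,a_k)$ are the points of a Poisson process with intensity (Lévy measure) $\lambda_c(dw)\,G(da)$. Let $c_\rho,c_\tau,\gamma_{0,\tau},c,\gamma_0,e,f>0$ and let $G_{0,\rho}$ be a finite measure on a measurable space $D$ (for example a continuous finite measure on a complete separable metric space). The graph gamma process (GGP) is the following hierarchical model. (i) Nodes. The triples $(\rho_i,d_i,\tau_i)_{i\ge1}$ enumerate the points of a Poisson process on $[0,\infty)\times D\times[0,\infty)$ whose intensity $\nu$ is the Lévy measure of a marked gamma process: no mass lies on $\{\rho=\tau=0\}$, the $(\rho,d)$-marginal of $\nu$ on $\{\rho>0\}$ is $\lambda_{c_\rho}(d\rho)\,G_{0,\rho}(dd)$, and its $\tau$-marginal on $\{\tau>0\}$ is $\gamma_{0,\tau}\lambda_{c_\tau}(d\tau)$ (the dependence between $\rho$ and $\tau$ is otherwise arbitrary). Write $\gamma_\rho=\sum_i\rho_i$ and $\gamma_\tau=\sum_j\tau_j$. (ii)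 Communities. Given the nodes, the communities $(r_\kappa,\boldsymbol\theta_\kappa,\boldsymbol\psi_\kappa)_{\kappa\ge1}$, with $\boldsymbol\theta_\kappa=(\theta_{i\kappa})_i$ and $\boldsymbol\psi_\kappa=(\psi_{j\kappa})_j$, enumerate the points of a Poisson process with intensity $\lambda_c(dr)\,\gamma_0 H(d\boldsymbol\theta\,d\boldsymbol\psi)$, i.e. the atoms of a gamma process with mass $\gamma_0$, where under $H$ all coordinates are independent, $\theta_i\sim\mathrm{Gamma}(\rho_i,1/e)$ and $\psi_j\sim\mathrm{Gamma}(\tau_j,1/f)$ (shape, scale; $\mathrm{Gamma}(0,\cdot)=\delta_0$). (iii) Edges. Given the nodes and communities, the $z_{ij\kappa}\sim\mathrm{Bernoulli}(1-e^{-r_\kappa\theta_{i\kappa}\psi_{j\kappa}})$ are independent, and $z_{ij}=\bigvee_\kappa z_{ij\kappa}$ is the adjacency matrix $\mathbf Z$ of a random directed graph on the countably many nodes. Then for all $i,j$, almost surely $\sum_\kappa r_\kappa\theta_{i\kappa}\psi_{j\kappa}<\infty$ and, given the nodes and communities, $z_{ij}=1$ with conditional probability $1-\exp(-\sum_\kappa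 r_\kappa\theta_{i\kappa}\psi_{j\kappa})$. The number of edges $\sum_i\sum_j z_{ij}$ is finite almost surely, and almost surely only finitely many nodes have nonzero degree. Moreover, almost surely $\gamma_\rho,\gamma_\tau<\infty$ and $$\mathbb E\Big[\sum_i\sum_j z_{ij}\,\Big|\,\text{nodes}\Big]\le\frac{\gamma_0\,\gamma_\rho\,\gamma_\tau}{c\,e\,f},$$ and $\mathbb E[\sum_i\sum_j z_{ij}]<\infty$. -/

import Mathlib

open MeasureTheory ProbabilityTheory Set
open scoped ENNReal NNReal

namespace GraphGamma

noncomputable section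

/-! ### Poisson processes -/

/-- The counting measure `∑ₙ δ_{xₙ}` of a sequence of points. -/
def atomMeasure {S : Type*} [MeasurableSpace S] (x : ℕ → S) : Measure S :=
  Measure.sum fun n => Measure.dirac (x n)

/-- `μ` is the law of an enumeration `x = (x₀, x₁, …)` of the points of a Poisson process on `S`
with intensity (Lévy) measure `ν`: the number of points in a measurable set `A` is Poisson with mean
`ν A` (almost surely infinite if `ν A = ∞`), and the numbers of points in finitely many pairwise
disjoint measurable sets are independent. -/
structure IsPoissonLaw {S : Type*} [MeasurableSpace S] (μ : Measure (ℕ → S)) (ν : Measure S) :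
    Prop where
  count_law : ∀ A : Set S, MeasurableSet A → ν A ≠ ∞ →
    μ.map (fun x => atomMeasure x A)
      = (poissonMeasure (ν A).toNNReal).map (fun n : ℕ => (n : ℝ≥0∞))
  count_infinite : ∀ A : Set S, MeasurableSet A → ν A = ∞ → ∀ᵐ x ∂μ, atomMeasure x A = ∞
  count_indep : ∀ (n : ℕ) (A : Fin n → Set S), (∀ k, MeasurableSet (A k)) →
    Pairwise (fun k l => Disjoint (A k) (A l)) →
    iIndepFun (fun k (x : ℕ → S) => atomMeasure x (A k)) μ

/-! ### Gamma processes -/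

/-- The measure `w⁻¹ e^{-c w} dw` on `(0, ∞)`, viewed as a measure on `ℝ`. A gamma process with
concentration parameter `c` and base measure `G` is `∑ w_k δ_{a_k}` for the points `(w_k, a_k)` of
a Poisson process with intensity `(gammaLevy c).prod G`. -/
def gammaLevy (c : ℝ) : Measure ℝ :=
  (volume.restrict (Ioi 0)).withDensity fun w => ENNReal.ofReal (w⁻¹ * Real.exp (-(c * w)))

/-- `ν` is the Lévy measure of a marked gamma process, on triples `(ρ, d, τ)` with location `d`:
the weights `ρ` and locations `d` form a gamma process with concentration parameter `cρ` and base
measure `G₀`, and the marks `τ` are the weights of a gamma process with concentration parameter `cτ`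
and mass `γτ`. A point may have `ρ = 0` or `τ = 0`, but not both; thus independent weights
and marks are included (`ν` is then carried by the two faces), and so is any other coupling. -/
structure IsMarkedGammaLevy {D : Type*} [MeasurableSpace D] (cρ : ℝ) (G₀ : Measure D)
    (cτ γτ : ℝ) (ν : Measure (ℝ × D × ℝ)) : Prop where
  nonneg : ∀ᵐ p ∂ν, 0 ≤ p.1 ∧ 0 ≤ p.2.2 ∧ (0 < p.1 ∨ 0 < p.2.2)
  weight_marginal :
    (ν.restrict {p | 0 < p.1}).map (fun p => (p.1, p.2.1)) = (gammaLevy cρ).prod G₀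
  mark_marginal :
    (ν.restrict {p | 0 < p.2.2}).map (fun p => p.2.2) = ENNReal.ofReal γτ • gammaLevy cτ

/-- The gamma distribution with shape `a ≥ 0` and rate `r > 0` (scale `1 / r`); for shape `0` it is
the point mass at `0`. (The value is not used for other parameters.) -/
def gammaLaw (a r : ℝ) : Measure ℝ :=
  open Classical in if 0 < a ∧ 0 < r then gammaMeasure a r else Measure.dirac 0

instance (a r : ℝ) : IsProbabilityMeasure (gammaLaw a r) := by
  unfold gammaLaw
  split_ifs with h
  · exact isProbabilityMeasure_gammaMeasure h.1 h.2
  · infer_instance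

/-! ### The graph gamma process -/

/-- The nodes: node `i` carries the triple `(ρ_i, d_i, τ_i)`. -/
abbrev Nodes (D : Type*) := ℕ → ℝ × D × ℝ

/-- The communities: community `κ` carries `(r_κ, (θ_{iκ})_i, (ψ_{jκ})_j)`. -/
abbrev Communities := ℕ → ℝ × (ℕ → ℝ) × (ℕ → ℝ)

/-- All the edge variables `z_{ijκ}`, indexed by `(i, j, κ)`. -/
abbrev EdgeArray := ℕ × ℕ × ℕ → Bool

/-- Given the nodes, the law of the affiliation vectors of a community: independent
`θ_i ∼ Gamma(ρ_i, 1/e)` and `ψ_j ∼ Gamma(τ_j, 1/f)`. -/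
def affiliationLaw {D : Type*} (e f : ℝ) (x : Nodes D) : Measure ((ℕ → ℝ) × (ℕ → ℝ)) :=
  (Measure.infinitePi fun i => gammaLaw (x i).1 e).prod
    (Measure.infinitePi fun j => gammaLaw (x j).2.2 f)

/-- Given the nodes, the Lévy measure `r⁻¹ e^{-c r} dr ⊗ γ₀ · affiliationLaw` of the gamma process
of communities; its base measure has total mass `γ₀`. -/
def communityLevy {D : Type*} (c γ₀ e f : ℝ) (x : Nodes D) : Measure (ℝ × (ℕ → ℝ) × (ℕ → ℝ)) :=
  (gammaLevy c).prod (ENNReal.ofReal γ₀ • affiliationLaw e f x)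

/-- The probability `1 - e^{-s}` (for `s ≥ 0`), as a point of the unit interval. -/
def edgeProb (s : ℝ) : unitInterval :=
  ⟨1 - Real.exp (-(max s 0)), by
    have h : Real.exp (-(max s 0)) ≤ 1 := Real.exp_le_one_iff.2 (by simp)
    have h' := Real.exp_pos (-(max s 0))
    constructor <;> linarith⟩

/-- Given the communities, the edge variables are independent and
`z_{ijκ} ∼ Bernoulli(1 - exp(-r_κ θ_{iκ} ψ_{jκ}))`. -/
def edgeLaw (y : Communities) : Measure EdgeArray :=
  Measure.infinitePi fun q : ℕ × ℕ × ℕ =>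
    bernoulliMeasure true false
      (edgeProb ((y q.2.2).1 * (y q.2.2).2.1 q.1 * (y q.2.2).2.2 q.2.1))

/-- `(X, Y, Z)` is a graph gamma process, with its nodes, communities and edge variables:
* the nodes `X` enumerate a marked gamma process with Lévy measure `ν`;
* given the nodes, the communities `Y` enumerate a gamma process with concentration parameter `c`
  whose base measure is `γ₀` times the law of the affiliation vectors;
* given the nodes and communities, the edge variables are independent Bernoulli variables. -/
structure IsGraphGammaProcess {Ω D : Type*} [MeasurableSpace Ω] [MeasurableSpace D]
    (P : Measure Ω) [IsProbabilityMeasure P] (ν : Measure (ℝ × D × ℝ)) (c γ₀ e f : ℝ)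
    (X : Ω → Nodes D) (Y : Ω → Communities) (Z : Ω → EdgeArray) : Prop where
  measurable_nodes : Measurable X
  measurable_communities : Measurable Y
  measurable_edges : Measurable Z
  nodes_law : IsPoissonLaw (P.map X) ν
  communities_law : ∀ᵐ x ∂(P.map X), IsPoissonLaw (condDistrib Y X P x) (communityLevy c γ₀ e f x)
  edges_law : ∀ᵐ p ∂(P.map fun ω => (X ω, Y ω)),
    condDistrib Z (fun ω => (X ω, Y ω)) P p = edgeLaw p.2

/-- The edge `(i, j)` is present in the random graph: `z_{ij} = ⋁_κ z_{ijκ} = 1`. -/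
def HasEdge (z : EdgeArray) (i j : ℕ) : Prop := ∃ κ, z (i, j, κ) = true

/-- The total number of edges `∑_i ∑_j z_{ij}`. -/
def edgeCount (z : EdgeArray) : ℝ≥0∞ :=
  open Classical in ∑' i, ∑' j, if HasEdge z i j then 1 else 0

/-- The total weight `∑_i ρ_i` of the nodes. -/
def totalWeight {D : Type*} (x : Nodes D) : ℝ≥0∞ := ∑' i, ENNReal.ofReal (x i).1

/-- The total mark `∑_j τ_j` of the nodes. -/
def totalMark {D : Type*} (x : Nodes D) : ℝ≥0∞ := ∑' j, ENNReal.ofReal (x j).2.2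

end

end GraphGamma

namespace GraphGamma

/-! ### Moments of the Poisson distribution -/

/-! Everything comes from first moments, except for one second moment. Since `1 - exp (-s) ≤ s`, a
union bound over communities makes the conditional probability of the edge `(i, j)` at most its rate
`∑ r_κ θ_{iκ} ψ_{jκ}` (`edgeLaw_hasEdge_le`). Given the nodes, Campbell's formula and the
independence built into the community intensity give this rate the mean `γ₀ * (1/c) * (ρ_i/e) *
(τ_j/f)` (`lintegral_edgeRate`), so the rate is almost surely finite. Summing over `i` and `j`
factorises the bound into `γ₀/(c e f)` times total weight times total mark
(`setLIntegral_edgeCount_le`).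

It remains to integrate the product of the two totals. Weights and marks may be coupled arbitrarily,
so the mean does not factor; the product is bounded by the sum of the squares, and each total has a
finite second moment because the first two moments of a gamma Lévy measure are finite
(`lintegral_tsum_sq_le`, `lintegral_ofReal_pow_gammaLevy`). The mean number of edges is therefore
finite, hence so are almost surely the number of edges and the number of their endpoints.

The exact edge probability is separate: an edge is absent when all its independent Bernoulli
variables vanish, and the product of the exponentials is the exponential of the sum
(`edgeLaw_real_hasEdge`). -/

lemma lintegral_poissonMeasure (r : ℝ≥0) (g : ℕ → ℝ≥0∞) :
    ∫⁻ n, g n ∂(poissonMeasure r)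
      = ∑' n : ℕ, ENNReal.ofReal (Real.exp (-r) * r ^ n / n.factorial) * g n := by
  simp [poissonMeasure, lintegral_sum_measure, lintegral_smul_measure]

/-- Size-biasing: `n * p n = r * p (n - 1)` for the Poisson weights `p`. Taking `g` constant, then
the identity, yields the first two moments. -/
lemma lintegral_natCast_mul_poissonMeasure (r : ℝ≥0) (g : ℕ → ℝ≥0∞) :
    ∫⁻ n, n * g n ∂(poissonMeasure r) = r * ∫⁻ n, g (n + 1) ∂(poissonMeasure r) := by
  rw [lintegral_poissonMeasure, lintegral_poissonMeasure, tsum_eq_zero_add' ENNReal.summable,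
    ← ENNReal.tsum_mul_left]
  simp only [Nat.cast_zero, zero_mul, mul_zero, zero_add]
  refine tsum_congr fun n => ?_
  have h : ENNReal.ofReal (Real.exp (-r) * r ^ (n + 1) / (n + 1).factorial) * ((n + 1 : ℕ) : ℝ≥0∞)
      = r * ENNReal.ofReal (Real.exp (-r) * r ^ n / n.factorial) := by
    rw [← ENNReal.ofReal_natCast, ← ENNReal.ofReal_mul (by positivity), ← ENNReal.ofReal_coe_nnreal,
      ← ENNReal.ofReal_mul (by positivity)]
    congr 1
    rw [Nat.factorial_succ]
    push_cast
    field_simp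
    ring
  rw [← mul_assoc, h, mul_assoc]

lemma lintegral_natCast_poissonMeasure (r : ℝ≥0) :
    ∫⁻ n, (n : ℝ≥0∞) ∂(poissonMeasure r) = r := by
  simpa using lintegral_natCast_mul_poissonMeasure r 1

lemma lintegral_natCast_sq_poissonMeasure (r : ℝ≥0) :
    ∫⁻ n, (n : ℝ≥0∞) ^ 2 ∂(poissonMeasure r) = r ^ 2 + r := by
  simp_rw [sq]
  rw [lintegral_natCast_mul_poissonMeasure]
  simp only [Nat.cast_add, Nat.cast_one]
  rw [lintegral_add_right _ measurable_const, lintegral_natCast_poissonMeasure]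
  simp [mul_add]

/-! ### Sums over the points of a Poisson process -/

variable {S : Type*} [MeasurableSpace S]

lemma lintegral_atomMeasure (x : ℕ → S) {f : S → ℝ≥0∞} (hf : Measurable f) :
    ∫⁻ s, f s ∂(atomMeasure x) = ∑' n, f (x n) := by
  simp [atomMeasure, lintegral_sum_measure, lintegral_dirac' _ hf]

lemma atomMeasure_apply (x : ℕ → S) {A : Set S} (hA : MeasurableSet A) :
    atomMeasure x A = ∑' n, A.indicator 1 (x n) := by
  simp [atomMeasure, Measure.sum_apply _ hA, Measure.dirac_apply' _ hA]

lemma measurable_atomMeasure_apply {A : Set S} (hA : MeasurableSet A) :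
    Measurable fun x : ℕ → S => atomMeasure x A := by
  simp_rw [atomMeasure_apply _ hA]
  refine Measurable.tsum fun n => ?_
  exact (measurable_one.indicator hA).comp (measurable_pi_apply n)

namespace IsPoissonLaw

variable {μ : Measure (ℕ → S)} {ν : Measure S}

lemma lintegral_count_sq_le (h : IsPoissonLaw μ ν) {A : Set S} (hA : MeasurableSet A) :
    ∫⁻ x, atomMeasure x A ^ 2 ∂μ ≤ ν A ^ 2 + ν A := by
  by_cases hν : ν A = ∞
  · simp [hν]
  · rw [← lintegral_map (f := fun t : ℝ≥0∞ => t ^ 2) (by fun_prop)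
        (measurable_atomMeasure_apply hA),
      h.count_law A hA hν, lintegral_map (by fun_prop) (by fun_prop),
      lintegral_natCast_sq_poissonMeasure, ENNReal.coe_toNNReal hν]

variable [IsProbabilityMeasure μ]

lemma lintegral_count (h : IsPoissonLaw μ ν) {A : Set S} (hA : MeasurableSet A) :
    ∫⁻ x, atomMeasure x A ∂μ = ν A := by
  by_cases hν : ν A = ∞
  · rw [lintegral_congr_ae (h.count_infinite A hA hν)]
    simp [hν]
  · rw [← lintegral_map (f := fun t : ℝ≥0∞ => t) (by fun_prop)
        (measurable_atomMeasure_apply hA),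
      h.count_law A hA hν, lintegral_map (by fun_prop) (by fun_prop),
      lintegral_natCast_poissonMeasure, ENNReal.coe_toNNReal hν]

lemma lintegral_count_mul_count (h : IsPoissonLaw μ ν) {A B : Set S} (hA : MeasurableSet A)
    (hB : MeasurableSet B) (hAB : Disjoint A B) :
    ∫⁻ x, atomMeasure x A * atomMeasure x B ∂μ = ν A * ν B := by
  have hind := (h.count_indep 2 ![A, B] (by simp [Fin.forall_fin_two, hA, hB])
    (by
      intro k l hkl
      fin_cases k <;> fin_cases l <;> simp_all [disjoint_comm])).indepFun
      (i := 0) (j := 1) (by simp)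
  have := lintegral_mul_eq_lintegral_mul_lintegral_of_indepFun
    (measurable_atomMeasure_apply hA) (measurable_atomMeasure_apply hB) hind
  simpa [h.lintegral_count hA, h.lintegral_count hB] using this

/-- The intensity is the mean measure of the points. -/
lemma sum_map_eval (h : IsPoissonLaw μ ν) :
    (Measure.sum fun n => μ.map fun x : ℕ → S => x n) = ν := by
  ext A hA
  rw [← h.lintegral_count hA]
  simp_rw [atomMeasure_apply _ hA]
  have hm (n : ℕ) : Measurable fun x : ℕ → S => A.indicator (1 : S → ℝ≥0∞) (x n) :=
    (measurable_one.indicator hA).comp (measurable_pi_apply n)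
  rw [Measure.sum_apply _ hA, lintegral_tsum fun n => (hm n).aemeasurable]
  refine tsum_congr fun n => ?_
  rw [Measure.map_apply (measurable_pi_apply n) hA,
    ← lintegral_indicator_one (hA.preimage (measurable_pi_apply n))]
  rfl

/-- Campbell's formula. -/
lemma lintegral_tsum_eq (h : IsPoissonLaw μ ν) {f : S → ℝ≥0∞} (hf : Measurable f) :
    ∫⁻ x, ∑' n, f (x n) ∂μ = ∫⁻ s, f s ∂ν := by
  have hm (n : ℕ) : Measurable fun x : ℕ → S => f (x n) := hf.comp (measurable_pi_apply n)
  rw [← h.sum_map_eval, lintegral_sum_measure, lintegral_tsum fun n => (hm n).aemeasurable]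
  exact tsum_congr fun n => (lintegral_map hf (measurable_pi_apply n)).symm

/-- The intensity is the sum of the laws of the coordinates, so a `ν`-null set is null for each of
these countably many laws. -/
lemma ae_forall (h : IsPoissonLaw μ ν) {p : S → Prop} (hp : ∀ᵐ s ∂ν, p s) :
    ∀ᵐ x ∂μ, ∀ n, p (x n) := by
  rw [← h.sum_map_eval, Measure.ae_sum_iff] at hp
  exact ae_all_iff.2 fun n => ae_of_ae_map (measurable_pi_apply n).aemeasurable (hp n)

/-- Expand the square over pairs of fibres. Distinct fibres are disjoint, so their counts are
independent and contribute the product of the means; a diagonal pair has an extra variance term `ν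
(g ⁻¹' {a})`, and these terms add up to the integral of `g ^ 2`. -/
lemma lintegral_simpleFunc_sq_le (h : IsPoissonLaw μ ν) (g : SimpleFunc S ℝ≥0∞) :
    ∫⁻ x, (g.lintegral (atomMeasure x)) ^ 2 ∂μ
      ≤ (g.lintegral ν) ^ 2 + (g.map fun t => t ^ 2).lintegral ν := by
  classical
  have hm (a : ℝ≥0∞) : Measurable fun x : ℕ → S => atomMeasure x (g ⁻¹' {a}) :=
    measurable_atomMeasure_apply (g.measurableSet_fiber a)
  have hle (a b : ℝ≥0∞) : ∫⁻ x, atomMeasure x (g ⁻¹' {a}) * atomMeasure x (g ⁻¹' {b}) ∂μ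
      ≤ ν (g ⁻¹' {a}) * ν (g ⁻¹' {b}) + if a = b then ν (g ⁻¹' {a}) else 0 := by
    split_ifs with hab
    · subst hab
      simpa [sq] using h.lintegral_count_sq_le (g.measurableSet_fiber a)
    · rw [h.lintegral_count_mul_count (g.measurableSet_fiber a) (g.measurableSet_fiber b)
        (Disjoint.preimage _ (by simpa using hab)), add_zero]
  calc ∫⁻ x, (g.lintegral (atomMeasure x)) ^ 2 ∂μ
      = ∑ a ∈ g.range, ∑ b ∈ g.range,
          a * b * ∫⁻ x, atomMeasure x (g ⁻¹' {a}) * atomMeasure x (g ⁻¹' {b}) ∂μ := by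
        simp_rw [SimpleFunc.lintegral, sq, Finset.sum_mul_sum]
        rw [lintegral_finsetSum _ fun a _ => by fun_prop]
        refine Finset.sum_congr rfl fun a _ => ?_
        rw [lintegral_finsetSum _ fun b _ => by fun_prop]
        refine Finset.sum_congr rfl fun b _ => ?_
        rw [← lintegral_const_mul _ (by fun_prop)]
        exact lintegral_congr fun x => by ring
    _ ≤ ∑ a ∈ g.range, ∑ b ∈ g.range,
          a * b * (ν (g ⁻¹' {a}) * ν (g ⁻¹' {b}) + if a = b then ν (g ⁻¹' {a}) else 0) := by
        gcongr with a _ b _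
        exact hle a b
    _ = _ := by
        rw [SimpleFunc.map_lintegral, SimpleFunc.lintegral, sq, Finset.sum_mul_sum,
          ← Finset.sum_add_distrib]
        refine Finset.sum_congr rfl fun a ha => ?_
        simp_rw [mul_add, Finset.sum_add_distrib, mul_ite, mul_zero]
        rw [Finset.sum_ite_eq, if_pos ha, sq]
        congr 1
        exact Finset.sum_congr rfl fun b _ => by ring

/-- The second moment of a sum over the points of a Poisson process. -/
lemma lintegral_tsum_sq_le (h : IsPoissonLaw μ ν) {f : S → ℝ≥0∞} (hf : Measurable f) :
    ∫⁻ x, (∑' n, f (x n)) ^ 2 ∂μ ≤ (∫⁻ s, f s ∂ν) ^ 2 + ∫⁻ s, f s ^ 2 ∂ν := by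
  have hmono (x : ℕ → S) : Monotone fun n => (SimpleFunc.eapprox f n).lintegral (atomMeasure x) :=
    fun m n hmn => SimpleFunc.lintegral_mono (SimpleFunc.monotone_eapprox f hmn) le_rfl
  -- Monotone convergence along the simple approximations of `f` extends the bound from simple
  -- functions.
  have htend := lintegral_tendsto_of_tendsto_of_monotone (μ := μ)
    (f := fun n x => ((SimpleFunc.eapprox f n).lintegral (atomMeasure x)) ^ 2)
    (F := fun x => (∑' n, f (x n)) ^ 2)
    (fun n => by
      refine Measurable.aemeasurable (Measurable.pow_const ?_ 2)
      unfold SimpleFunc.lintegral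
      exact Finset.measurable_fun_sum _ fun a _ =>
        (measurable_atomMeasure_apply (SimpleFunc.measurableSet_fiber _ a)).const_mul a)
    (ae_of_all _ fun x m n hmn => pow_le_pow_left' (hmono x hmn) 2)
    (ae_of_all _ fun x => by
      rw [← lintegral_atomMeasure x hf, lintegral_eq_iSup_eapprox_lintegral hf]
      exact ((ENNReal.continuous_pow 2).tendsto _).comp (tendsto_atTop_iSup (hmono x)))
  refine le_of_tendsto' htend fun n => (h.lintegral_simpleFunc_sq_le _).trans ?_
  gcongr
  · exact lintegral_eapprox_le_lintegral hf n
  · rw [← SimpleFunc.lintegral_eq_lintegral]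
    refine lintegral_mono fun s => ?_
    simp only [SimpleFunc.coe_map, Function.comp_apply]
    gcongr
    rw [← SimpleFunc.iSup_eapprox_apply hf s]
    exact le_iSup (fun n => SimpleFunc.eapprox f n s) n

end IsPoissonLaw

/-! ### Moments of gamma distributions and Lévy measures -/

lemma measurable_gammaPDF (a r : ℝ) : Measurable (gammaPDF a r) :=
  (measurable_gammaPDFReal a r).ennreal_ofReal

lemma ae_gammaLevy_pos (c : ℝ) : ∀ᵐ w ∂(gammaLevy c), 0 < w :=
  (withDensity_absolutelyContinuous _ _).ae_le (ae_restrict_mem measurableSet_Ioi)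

instance (c : ℝ) : SFinite (gammaLevy c) := by
  unfold gammaLevy
  infer_instance

lemma ae_gammaLaw_nonneg (a r : ℝ) : ∀ᵐ w ∂(gammaLaw a r), 0 ≤ w := by
  unfold gammaLaw
  split_ifs with h
  · rw [gammaMeasure, ae_withDensity_iff (measurable_gammaPDF a r)]
    refine ae_of_all _ fun x hx => ?_
    by_contra! hneg
    exact hx (gammaPDF_of_neg hneg)
  · rw [ae_dirac_iff measurableSet_Ici]

/-- One power of `w` cancels the singular factor `w⁻¹`, leaving an unnormalised gamma density of
shape `k + 1` and rate `c`. -/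
lemma lintegral_ofReal_pow_gammaLevy {c : ℝ} (hc : 0 < c) (k : ℕ) :
    ∫⁻ w, ENNReal.ofReal w ^ (k + 1) ∂(gammaLevy c)
      = ENNReal.ofReal (Real.Gamma (k + 1) / c ^ (k + 1)) := by
  have hk : (0 : ℝ) < k + 1 := by positivity
  have hΓ := Real.Gamma_pos_of_pos hk
  rw [gammaLevy, lintegral_withDensity_eq_lintegral_mul _ (by fun_prop) (by fun_prop)]
  calc _ = ∫⁻ w in Ioi 0, ENNReal.ofReal (Real.Gamma (k + 1) / c ^ (k + 1))
              * gammaPDF (k + 1) c w := by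
        refine setLIntegral_congr_fun measurableSet_Ioi fun w (hw : 0 < w) => ?_
        simp only [Pi.mul_apply]
        rw [gammaPDF_of_nonneg hw.le, ← ENNReal.ofReal_pow hw.le,
          ← ENNReal.ofReal_mul (by positivity), ← ENNReal.ofReal_mul (by positivity)]
        congr 1
        rw [add_sub_cancel_right, Real.rpow_natCast, ← Nat.cast_succ, Real.rpow_natCast]
        push_cast
        field_simp
        ring
    _ = ENNReal.ofReal (Real.Gamma (k + 1) / c ^ (k + 1)) * ∫⁻ w, gammaPDF (k + 1) c w := by
        rw [lintegral_const_mul _ (measurable_gammaPDF _ _)]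
        congr 1
        rw [← lintegral_add_compl (gammaPDF (k + 1) c) measurableSet_Ici (μ := volume), compl_Ici,
          lintegral_gammaPDF_of_nonpos le_rfl, add_zero, restrict_Ioi_eq_restrict_Ici]
    _ = _ := by rw [lintegral_gammaPDF_eq_one hk hc, mul_one]

lemma lintegral_ofReal_gammaLevy {c : ℝ} (hc : 0 < c) :
    ∫⁻ w, ENNReal.ofReal w ∂(gammaLevy c) = ENNReal.ofReal (1 / c) := by
  simpa using lintegral_ofReal_pow_gammaLevy hc 0

/-- Size-biasing again: `w` times the density of shape `a` is `a / r` times the density of shape `a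
+ 1`. For `a ≤ 0` the law is the point mass at `0`, and `ENNReal.ofReal` truncates the right side to
`0` as well. -/
lemma lintegral_ofReal_gammaLaw (a : ℝ) {r : ℝ} (hr : 0 < r) :
    ∫⁻ w, ENNReal.ofReal w ∂(gammaLaw a r) = ENNReal.ofReal (a / r) := by
  unfold gammaLaw
  split_ifs with h
  · have ha := h.1
    have hΓ := Real.Gamma_pos_of_pos ha
    rw [gammaMeasure, lintegral_withDensity_eq_lintegral_mul _ (measurable_gammaPDF a r)
      (by fun_prop)]
    calc _ = ∫⁻ w, ENNReal.ofReal (a / r) * gammaPDF (a + 1) r w := by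
          refine lintegral_congr fun w => ?_
          simp only [Pi.mul_apply]
          rcases lt_trichotomy w 0 with hw | rfl | hw
          · simp [gammaPDF_of_neg hw]
          · simp [gammaPDF_of_nonneg, Real.zero_rpow ha.ne']
          · rw [gammaPDF_of_nonneg hw.le, gammaPDF_of_nonneg hw.le,
              ← ENNReal.ofReal_mul (by positivity), ← ENNReal.ofReal_mul (by positivity)]
            congr 1
            rw [Real.Gamma_add_one ha.ne', Real.rpow_add_one hr.ne', add_sub_cancel_right,
              Real.rpow_sub_one hw.ne']
            field_simp
      _ = _ := by
          rw [lintegral_const_mul _ (measurable_gammaPDF _ _),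
            lintegral_gammaPDF_eq_one (by positivity) hr, mul_one]
  · have ha : a ≤ 0 := not_lt.1 fun ha => h ⟨ha, hr⟩
    rw [lintegral_dirac, ENNReal.ofReal_zero,
      ENNReal.ofReal_of_nonpos (div_nonpos_of_nonpos_of_nonneg ha hr.le)]

namespace IsMarkedGammaLevy

variable {D : Type*} [MeasurableSpace D] {cρ cτ γτ : ℝ} {G₀ : Measure D}
  {ν : Measure (ℝ × D × ℝ)}

/-- The marginal is prescribed only on `{ρ > 0}`; `hg0` makes the points outside this set invisible
to the integral. -/
lemma lintegral_weight [SFinite G₀] (h : IsMarkedGammaLevy cρ G₀ cτ γτ ν) {g : ℝ → ℝ≥0∞}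
    (hg : Measurable g) (hg0 : ∀ w ≤ 0, g w = 0) :
    ∫⁻ p, g p.1 ∂ν = (∫⁻ w, g w ∂(gammaLevy cρ)) * G₀ univ := by
  have hs : MeasurableSet {p : ℝ × D × ℝ | 0 < p.1} :=
    measurableSet_lt measurable_const measurable_fst
  have h1 : ∫⁻ p, g p.1 ∂ν = ∫⁻ p in {p | 0 < p.1}, g p.1 ∂ν := by
    rw [← lintegral_indicator hs]
    refine lintegral_congr fun p => ?_
    by_cases hp : 0 < p.1
    · simp [indicator, hp]
    · simp [indicator, hp, hg0 _ (not_lt.1 hp)]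
  have h2 : ∫⁻ p in {p | 0 < p.1}, g p.1 ∂ν = ∫⁻ q, g q.1 ∂((gammaLevy cρ).prod G₀) := by
    rw [← h.weight_marginal, lintegral_map (by fun_prop) (by fun_prop)]
  rw [h1, h2, lintegral_prod _ (by fun_prop)]
  simp [lintegral_mul_const _ hg]

lemma lintegral_mark (h : IsMarkedGammaLevy cρ G₀ cτ γτ ν) {g : ℝ → ℝ≥0∞}
    (hg : Measurable g) (hg0 : ∀ w ≤ 0, g w = 0) :
    ∫⁻ p, g p.2.2 ∂ν = ENNReal.ofReal γτ * ∫⁻ w, g w ∂(gammaLevy cτ) := by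
  have hs : MeasurableSet {p : ℝ × D × ℝ | 0 < p.2.2} :=
    measurableSet_lt measurable_const (by fun_prop)
  have h1 : ∫⁻ p, g p.2.2 ∂ν = ∫⁻ p in {p | 0 < p.2.2}, g p.2.2 ∂ν := by
    rw [← lintegral_indicator hs]
    refine lintegral_congr fun p => ?_
    by_cases hp : 0 < p.2.2
    · simp [indicator, hp]
    · simp [indicator, hp, hg0 _ (not_lt.1 hp)]
  rw [h1, ← smul_eq_mul, ← lintegral_smul_measure, ← h.mark_marginal,
    lintegral_map hg (by fun_prop)]

lemma lintegral_weight_pow_lt_top [IsFiniteMeasure G₀] (h : IsMarkedGammaLevy cρ G₀ cτ γτ ν)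
    (hcρ : 0 < cρ) (k : ℕ) : ∫⁻ p, ENNReal.ofReal p.1 ^ (k + 1) ∂ν < ∞ := by
  rw [h.lintegral_weight (g := fun w => ENNReal.ofReal w ^ (k + 1)) (by fun_prop)
    fun w hw => by simp [ENNReal.ofReal_of_nonpos hw], lintegral_ofReal_pow_gammaLevy hcρ]
  exact ENNReal.mul_lt_top ENNReal.ofReal_lt_top (measure_lt_top _ _)

lemma lintegral_mark_pow_lt_top (h : IsMarkedGammaLevy cρ G₀ cτ γτ ν)
    (hcτ : 0 < cτ) (k : ℕ) : ∫⁻ p, ENNReal.ofReal p.2.2 ^ (k + 1) ∂ν < ∞ := by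
  rw [h.lintegral_mark (g := fun w => ENNReal.ofReal w ^ (k + 1)) (by fun_prop)
    fun w hw => by simp [ENNReal.ofReal_of_nonpos hw], lintegral_ofReal_pow_gammaLevy hcτ]
  exact ENNReal.mul_lt_top ENNReal.ofReal_lt_top ENNReal.ofReal_lt_top

end IsMarkedGammaLevy

/-! ### The nodes -/

section Nodes

variable {D : Type*} [MeasurableSpace D]

lemma measurable_totalWeight : Measurable (totalWeight : Nodes D → ℝ≥0∞) := by
  unfold totalWeight
  fun_prop

lemma measurable_totalMark : Measurable (totalMark : Nodes D → ℝ≥0∞) := by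
  unfold totalMark
  fun_prop

variable {cρ cτ γτ : ℝ} {G₀ : Measure D} {ν : Measure (ℝ × D × ℝ)} {μ : Measure (Nodes D)}
  [IsProbabilityMeasure μ]

lemma lintegral_totalWeight_sq_lt_top [IsFiniteMeasure G₀]
    (hν : IsMarkedGammaLevy cρ G₀ cτ γτ ν) (hcρ : 0 < cρ) (hμ : IsPoissonLaw μ ν) :
    ∫⁻ x, totalWeight x ^ 2 ∂μ < ∞ := by
  refine (hμ.lintegral_tsum_sq_le (f := fun p => ENNReal.ofReal p.1) (by fun_prop)).trans_lt ?_
  have h1 := hν.lintegral_weight_pow_lt_top hcρ 0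
  have h2 := hν.lintegral_weight_pow_lt_top hcρ 1
  simp only [zero_add, pow_one, Nat.reduceAdd] at h1 h2
  exact ENNReal.add_lt_top.2 ⟨ENNReal.pow_lt_top h1, h2⟩

lemma lintegral_totalMark_sq_lt_top
    (hν : IsMarkedGammaLevy cρ G₀ cτ γτ ν) (hcτ : 0 < cτ) (hμ : IsPoissonLaw μ ν) :
    ∫⁻ x, totalMark x ^ 2 ∂μ < ∞ := by
  refine (hμ.lintegral_tsum_sq_le (f := fun p => ENNReal.ofReal p.2.2) (by fun_prop)).trans_lt ?_
  have h1 := hν.lintegral_mark_pow_lt_top hcτ 0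
  have h2 := hν.lintegral_mark_pow_lt_top hcτ 1
  simp only [zero_add, pow_one, Nat.reduceAdd] at h1 h2
  exact ENNReal.add_lt_top.2 ⟨ENNReal.pow_lt_top h1, h2⟩

lemma mul_le_sq_add_sq (a b : ℝ≥0∞) : a * b ≤ a ^ 2 + b ^ 2 := by
  rcases le_total a b with h | h
  · calc a * b ≤ b * b := by gcongr
      _ = b ^ 2 := (sq b).symm
      _ ≤ _ := le_add_self
  · calc a * b ≤ a * a := by gcongr
      _ = a ^ 2 := (sq a).symm
      _ ≤ _ := le_self_add

lemma lintegral_totalWeight_mul_totalMark_lt_top [IsFiniteMeasure G₀]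
    (hν : IsMarkedGammaLevy cρ G₀ cτ γτ ν) (hcρ : 0 < cρ) (hcτ : 0 < cτ)
    (hμ : IsPoissonLaw μ ν) :
    ∫⁻ x, totalWeight x * totalMark x ∂μ < ∞ := by
  refine (lintegral_mono fun x => mul_le_sq_add_sq _ _).trans_lt ?_
  rw [lintegral_add_left (measurable_totalWeight.pow_const 2)]
  exact ENNReal.add_lt_top.2 ⟨lintegral_totalWeight_sq_lt_top hν hcρ hμ,
    lintegral_totalMark_sq_lt_top hν hcτ hμ⟩

lemma ae_total_lt_top [IsFiniteMeasure G₀]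
    (hν : IsMarkedGammaLevy cρ G₀ cτ γτ ν) (hcρ : 0 < cρ) (hcτ : 0 < cτ)
    (hμ : IsPoissonLaw μ ν) :
    ∀ᵐ x ∂μ, totalWeight x < ∞ ∧ totalMark x < ∞ := by
  filter_upwards [ae_lt_top (measurable_totalWeight.pow_const 2)
      (lintegral_totalWeight_sq_lt_top hν hcρ hμ).ne,
    ae_lt_top (measurable_totalMark.pow_const 2)
      (lintegral_totalMark_sq_lt_top hν hcτ hμ).ne] with x h1 h2
  simpa using And.intro h1 h2

end Nodes

/-! ### The edges, given the communities -/

lemma setOf_hasEdge_eq_iUnion (i j : ℕ) :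
    {z : EdgeArray | HasEdge z i j} = ⋃ κ, (fun z : EdgeArray => z (i, j, κ)) ⁻¹' {true} := by
  ext z
  simp [HasEdge]

lemma measurableSet_hasEdge (i j : ℕ) : MeasurableSet {z : EdgeArray | HasEdge z i j} := by
  rw [setOf_hasEdge_eq_iUnion]
  exact MeasurableSet.iUnion fun κ => measurable_pi_apply _ (measurableSet_singleton _)

lemma edgeCount_eq_tsum_indicator (z : EdgeArray) :
    edgeCount z = ∑' i, ∑' j, {z | HasEdge z i j}.indicator 1 z := by
  classical
  simp only [edgeCount, indicator, mem_ofPred_eq, Pi.one_apply]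

lemma measurable_edgeCount : Measurable edgeCount := by
  simp_rw [funext edgeCount_eq_tsum_indicator]
  exact Measurable.tsum fun i => Measurable.tsum fun j =>
    measurable_one.indicator (measurableSet_hasEdge i j)

lemma hasProd_ofReal_exp_neg {ι : Type*} {s : ι → ℝ} (hs : Summable s) :
    HasProd (fun k => ENNReal.ofReal (Real.exp (-s k)))
      (ENNReal.ofReal (Real.exp (-∑' k, s k))) := by
  have h : Filter.Tendsto (fun F : Finset ι => ENNReal.ofReal (Real.exp (-∑ k ∈ F, s k)))
      Filter.atTop (nhds (ENNReal.ofReal (Real.exp (-∑' k, s k)))) := by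
    refine ENNReal.tendsto_ofReal ((Real.continuous_exp.tendsto _).comp ?_)
    exact Filter.Tendsto.neg hs.hasSum
  refine Filter.Tendsto.congr (fun F => ?_) h
  rw [← Finset.sum_neg_distrib, Real.exp_sum,
    ENNReal.ofReal_prod_of_nonneg fun k _ => (Real.exp_pos _).le]

lemma bernoulliMeasure_edgeProb_false (s : ℝ) :
    bernoulliMeasure true false (edgeProb s) {false} = ENNReal.ofReal (Real.exp (-(max s 0))) := by
  rw [← ofReal_measureReal,
    bernoulliMeasure_real_apply_of_notMem_of_mem _ (by simp) (by simp) (by simp)]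
  simp [edgeProb]

lemma bernoulliMeasure_edgeProb_true_le (s : ℝ) :
    bernoulliMeasure true false (edgeProb s) {true} ≤ ENNReal.ofReal s := by
  rw [← ofReal_measureReal,
    bernoulliMeasure_real_apply_of_mem_of_notMem _ (by simp) (by simp) (by simp)]
  refine ENNReal.ofReal_le_of_le_toReal ?_
  rw [ENNReal.toReal_ofReal', edgeProb]
  have := Real.add_one_le_exp (-(max s 0))
  dsimp only
  linarith

instance (y : Communities) : IsProbabilityMeasure (edgeLaw y) := by
  unfold edgeLaw
  infer_instance

/-- Union bound over communities. Neither positivity nor summability is required, since `edgeProb`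
and `ENNReal.ofReal` truncate negative rates alike and the sum may be infinite. -/
lemma edgeLaw_hasEdge_le (y : Communities) (i j : ℕ) :
    edgeLaw y {z | HasEdge z i j}
      ≤ ∑' κ, ENNReal.ofReal ((y κ).1 * (y κ).2.1 i * (y κ).2.2 j) := by
  rw [setOf_hasEdge_eq_iUnion]
  refine (measure_iUnion_le _).trans (ENNReal.tsum_le_tsum fun κ => ?_)
  rw [← Measure.map_apply (measurable_pi_apply _) (measurableSet_singleton _), edgeLaw,
    Measure.infinitePi_map_eval]
  exact bernoulliMeasure_edgeProb_true_le _

lemma edgeLaw_real_hasEdge (y : Communities) (i j : ℕ)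
    (h0 : ∀ κ, 0 ≤ (y κ).1 * (y κ).2.1 i * (y κ).2.2 j)
    (hs : Summable fun κ => (y κ).1 * (y κ).2.1 i * (y κ).2.2 j) :
    (edgeLaw y).real {z | HasEdge z i j}
      = 1 - Real.exp (-∑' κ, (y κ).1 * (y κ).2.1 i * (y κ).2.2 j) := by
  have hinj : Function.Injective fun κ : ℕ => (i, j, κ) := fun a b hab => by simpa using hab
  have hc : {z : EdgeArray | HasEdge z i j}ᶜ
      = Set.pi (range fun κ : ℕ => (i, j, κ)) fun _ => {false} := by
    ext z
    simp [HasEdge]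
  have hcompl : edgeLaw y {z | HasEdge z i j}ᶜ
      = ENNReal.ofReal (Real.exp (-∑' κ, (y κ).1 * (y κ).2.1 i * (y κ).2.2 j)) := by
    -- The absence of the edge is a cylinder over the countable set of triples `(i, j, κ)`;
    -- injectivity reindexes the product by `κ`.
    rw [hc, edgeLaw, Measure.infinitePi_pi_of_countable _ (countable_range _)
      fun _ _ => measurableSet_singleton _, ← (Equiv.ofInjective _ hinj).tprod_eq]
    simp only [Equiv.ofInjective_apply, bernoulliMeasure_edgeProb_false, max_eq_left (h0 _)]
    exact (hasProd_ofReal_exp_neg hs).tprod_eq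
  have := probReal_compl_eq_one_sub (μ := edgeLaw y) (measurableSet_hasEdge i j)
  rw [measureReal_def, hcompl, ENNReal.toReal_ofReal (Real.exp_pos _).le] at this
  linarith

/-! ### The communities, given the nodes -/

lemma ae_communityLevy {D : Type*} (c γ₀ e f : ℝ) (x : Nodes D) :
    ∀ᵐ s ∂(communityLevy c γ₀ e f x), 0 < s.1 ∧ (∀ i, 0 ≤ s.2.1 i) ∧ ∀ j, 0 ≤ s.2.2 j := by
  have h1 : ∀ᵐ s ∂(communityLevy c γ₀ e f x), 0 < s.1 :=
    Measure.quasiMeasurePreserving_fst.ae (ae_gammaLevy_pos c)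
  have hθ : ∀ᵐ a ∂(affiliationLaw e f x), ∀ i, 0 ≤ a.1 i :=
    Measure.quasiMeasurePreserving_fst.ae <| ae_all_iff.2 fun i =>
      (measurePreserving_eval_infinitePi _ i).quasiMeasurePreserving.ae (ae_gammaLaw_nonneg _ _)
  have hψ : ∀ᵐ a ∂(affiliationLaw e f x), ∀ j, 0 ≤ a.2 j :=
    Measure.quasiMeasurePreserving_snd.ae <| ae_all_iff.2 fun i =>
      (measurePreserving_eval_infinitePi _ i).quasiMeasurePreserving.ae (ae_gammaLaw_nonneg _ _)
  have h2 : ∀ᵐ s ∂(communityLevy c γ₀ e f x), (∀ i, 0 ≤ s.2.1 i) ∧ ∀ j, 0 ≤ s.2.2 j :=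
    Measure.quasiMeasurePreserving_snd.ae (Measure.ae_smul_measure (hθ.and hψ) _)
  exact h1.and h2

instance {D : Type*} (e f : ℝ) (x : Nodes D) : IsProbabilityMeasure (affiliationLaw e f x) := by
  unfold affiliationLaw
  infer_instance

lemma lintegral_communityLevy {D : Type*} {c γ₀ e f : ℝ} (hc : 0 < c) (hγ₀ : 0 < γ₀) (he : 0 < e)
    (hf : 0 < f) (x : Nodes D) (i j : ℕ) :
    ∫⁻ s, ENNReal.ofReal (s.1 * s.2.1 i * s.2.2 j) ∂(communityLevy c γ₀ e f x)
      = ENNReal.ofReal (γ₀ / (c * e * f)) *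
        (ENNReal.ofReal (x i).1 * ENNReal.ofReal (x j).2.2) := by
  -- `ENNReal.ofReal` is multiplicative only on nonnegative factors, which the intensity guarantees
  -- almost everywhere.
  have hsplit : ∫⁻ s, ENNReal.ofReal (s.1 * s.2.1 i * s.2.2 j) ∂(communityLevy c γ₀ e f x)
      = ∫⁻ s, ENNReal.ofReal s.1 * (ENNReal.ofReal (s.2.1 i) * ENNReal.ofReal (s.2.2 j))
        ∂(communityLevy c γ₀ e f x) := by
    refine lintegral_congr_ae ?_
    filter_upwards [ae_communityLevy c γ₀ e f x] with s hs
    rw [mul_assoc, ENNReal.ofReal_mul hs.1.le, ENNReal.ofReal_mul (hs.2.1 i)]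
  have heval (g : ℕ → ℝ) (r : ℝ) (hr : 0 < r) (k : ℕ) :
      ∫⁻ t, ENNReal.ofReal (t k) ∂(Measure.infinitePi fun i => gammaLaw (g i) r)
        = ENNReal.ofReal (g k / r) := by
    rw [← lintegral_ofReal_gammaLaw (g k) hr,
      ← Measure.infinitePi_map_eval (fun i => gammaLaw (g i) r) k,
      lintegral_map (by fun_prop) (by fun_prop)]
  rw [hsplit, communityLevy, lintegral_prod_mul (f := fun w => ENNReal.ofReal w)
    (g := fun a : (ℕ → ℝ) × (ℕ → ℝ) => ENNReal.ofReal (a.1 i) * ENNReal.ofReal (a.2 j))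
    (by fun_prop) (by fun_prop), lintegral_ofReal_gammaLevy hc, lintegral_smul_measure,
    affiliationLaw, lintegral_prod_mul (f := fun t : ℕ → ℝ => ENNReal.ofReal (t i))
    (g := fun t : ℕ → ℝ => ENNReal.ofReal (t j))
    (Measurable.aemeasurable (by fun_prop)) (Measurable.aemeasurable (by fun_prop)),
    heval (fun i => (x i).1) e he, heval (fun j => (x j).2.2) f hf, smul_eq_mul]
  rw [div_eq_mul_inv (x i).1, div_eq_mul_inv (x j).2.2,
    ENNReal.ofReal_mul' (inv_nonneg.2 he.le), ENNReal.ofReal_mul' (inv_nonneg.2 hf.le)]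
  have : ENNReal.ofReal (γ₀ / (c * e * f))
      = ENNReal.ofReal (1 / c) * (ENNReal.ofReal γ₀ *
        (ENNReal.ofReal e⁻¹ * ENNReal.ofReal f⁻¹)) := by
    rw [← ENNReal.ofReal_mul (by positivity), ← ENNReal.ofReal_mul (by positivity),
      ← ENNReal.ofReal_mul (by positivity)]
    congr 1
    field_simp
  rw [this]
  ring

/-- The total rate `∑_κ r_κ θ_{iκ} ψ_{jκ}` of the edge `(i, j)`. -/
noncomputable def edgeRate (i j : ℕ) (y : Communities) : ℝ≥0∞ :=
  ∑' κ, ENNReal.ofReal ((y κ).1 * (y κ).2.1 i * (y κ).2.2 j)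

lemma measurable_edgeRate (i j : ℕ) : Measurable (edgeRate i j) := by
  unfold edgeRate
  fun_prop

lemma lintegral_edgeRate {D : Type*} {c γ₀ e f : ℝ} (hc : 0 < c) (hγ₀ : 0 < γ₀)
    (he : 0 < e) (hf : 0 < f) {x : Nodes D} {μ : Measure Communities} [IsProbabilityMeasure μ]
    (hμ : IsPoissonLaw μ (communityLevy c γ₀ e f x)) (i j : ℕ) :
    ∫⁻ y, edgeRate i j y ∂μ
      = ENNReal.ofReal (γ₀ / (c * e * f)) *
        (ENNReal.ofReal (x i).1 * ENNReal.ofReal (x j).2.2) := by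
  rw [← lintegral_communityLevy hc hγ₀ he hf]
  exact hμ.lintegral_tsum_eq (f := fun s => ENNReal.ofReal (s.1 * s.2.1 i * s.2.2 j)) (by fun_prop)

lemma measurableSet_nonneg_communities :
    MeasurableSet {y : Communities |
      ∀ κ, 0 < (y κ).1 ∧ (∀ i, 0 ≤ (y κ).2.1 i) ∧ ∀ j, 0 ≤ (y κ).2.2 j} := by
  measurability

lemma summable_of_edgeRate_ne_top {y : Communities} {i j : ℕ} (h : edgeRate i j y ≠ ∞)
    (h0 : ∀ κ, 0 ≤ (y κ).1 * (y κ).2.1 i * (y κ).2.2 j) :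
    Summable fun κ => (y κ).1 * (y κ).2.1 i * (y κ).2.2 j := by
  refine (ENNReal.summable_toReal h).congr fun κ => ?_
  rw [ENNReal.toReal_ofReal (h0 κ)]

lemma finite_nodes_of_edgeCount_lt_top {z : EdgeArray} (h : edgeCount z < ∞) :
    {i | ∃ j, HasEdge z i j ∨ HasEdge z j i}.Finite := by
  classical
  have hfin : {q : ℕ × ℕ | HasEdge z q.1 q.2}.Finite := by
    have h' : ∑' q : ℕ × ℕ, (if HasEdge z q.1 q.2 then 1 else 0 : ℝ≥0∞) ≠ ∞ := by
      rw [ENNReal.tsum_prod (f := fun i j => (if HasEdge z i j then 1 else 0 : ℝ≥0∞))]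
      convert h.ne
      unfold edgeCount
      congr!
    refine (ENNReal.finite_const_le_of_tsum_ne_top h' one_ne_zero).subset fun q hq => ?_
    simp_all
  refine ((hfin.image Prod.fst).union (hfin.image Prod.snd)).subset ?_
  rintro i ⟨j, hj | hj⟩
  · exact Or.inl ⟨(i, j), hj, rfl⟩
  · exact Or.inr ⟨(j, i), hj, rfl⟩

/-! ### Disintegration of the graph gamma process -/

namespace IsGraphGammaProcess

variable {Ω D : Type*} [MeasurableSpace Ω] [MeasurableSpace D] {P : Measure Ω}
  [IsProbabilityMeasure P] {ν : Measure (ℝ × D × ℝ)} {c γ₀ e f : ℝ}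
  {X : Ω → Nodes D} {Y : Ω → Communities} {Z : Ω → EdgeArray}

/-- The joint law of `(X, Y)` is the law of `X` composed with the conditional kernel, which carries
conditional almost sure statements back to `P`. -/
lemma ae_communities_of_ae (h : IsGraphGammaProcess P ν c γ₀ e f X Y Z) {p : Communities → Prop}
    (hp : MeasurableSet {y | p y}) (hae : ∀ᵐ x ∂(P.map X), ∀ᵐ y ∂(condDistrib Y X P x), p y) :
    ∀ᵐ ω ∂P, p (Y ω) := by
  have hm := h.measurable_nodes.prodMk h.measurable_communities
  have h1 : ∀ᵐ q ∂(P.map fun ω => (X ω, Y ω)), p q.2 := by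
    rw [← compProd_map_condDistrib h.measurable_communities.aemeasurable]
    exact Measure.ae_compProd_of_ae_ae (measurable_snd hp) hae
  exact ae_of_ae_map hm.aemeasurable h1

lemma ae_communities_nonneg (h : IsGraphGammaProcess P ν c γ₀ e f X Y Z) :
    ∀ᵐ ω ∂P, ∀ κ, 0 < (Y ω κ).1 ∧ (∀ i, 0 ≤ (Y ω κ).2.1 i) ∧ ∀ j, 0 ≤ (Y ω κ).2.2 j := by
  refine h.ae_communities_of_ae measurableSet_nonneg_communities ?_
  filter_upwards [h.communities_law] with x hx
  exact hx.ae_forall (ae_communityLevy c γ₀ e f x)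

lemma ae_edgeRate_lt_top (h : IsGraphGammaProcess P ν c γ₀ e f X Y Z) (hc : 0 < c) (hγ₀ : 0 < γ₀)
    (he : 0 < e) (hf : 0 < f) (i j : ℕ) : ∀ᵐ ω ∂P, edgeRate i j (Y ω) < ∞ := by
  refine h.ae_communities_of_ae (measurableSet_lt (measurable_edgeRate i j) measurable_const) ?_
  filter_upwards [h.communities_law] with x hx
  refine ae_lt_top (measurable_edgeRate i j) ?_
  rw [lintegral_edgeRate hc hγ₀ he hf hx]
  exact ENNReal.mul_ne_top ENNReal.ofReal_ne_top
    (ENNReal.mul_ne_top ENNReal.ofReal_ne_top ENNReal.ofReal_ne_top)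

lemma ae_summable (h : IsGraphGammaProcess P ν c γ₀ e f X Y Z) (hc : 0 < c) (hγ₀ : 0 < γ₀)
    (he : 0 < e) (hf : 0 < f) (i j : ℕ) :
    ∀ᵐ ω ∂P, (∀ κ, 0 ≤ (Y ω κ).1 * (Y ω κ).2.1 i * (Y ω κ).2.2 j) ∧
      Summable fun κ => (Y ω κ).1 * (Y ω κ).2.1 i * (Y ω κ).2.2 j := by
  filter_upwards [h.ae_communities_nonneg, h.ae_edgeRate_lt_top hc hγ₀ he hf i j] with ω h0 hlt
  have h0' (κ : ℕ) : 0 ≤ (Y ω κ).1 * (Y ω κ).2.1 i * (Y ω κ).2.2 j :=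
    mul_nonneg (mul_nonneg (h0 κ).1.le ((h0 κ).2.1 i)) ((h0 κ).2.2 j)
  exact ⟨h0', summable_of_edgeRate_ne_top hlt.ne h0'⟩

lemma ae_condDistrib_edges (h : IsGraphGammaProcess P ν c γ₀ e f X Y Z) :
    ∀ᵐ ω ∂P, condDistrib Z (fun ω => (X ω, Y ω)) P (X ω, Y ω) = edgeLaw (Y ω) :=
  ae_of_ae_map (h.measurable_nodes.prodMk h.measurable_communities).aemeasurable h.edges_law

lemma condExp_hasEdge (h : IsGraphGammaProcess P ν c γ₀ e f X Y Z) (hc : 0 < c) (hγ₀ : 0 < γ₀)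
    (he : 0 < e) (hf : 0 < f) (i j : ℕ) :
    P⟦{ω | HasEdge (Z ω) i j} | MeasurableSpace.comap (fun ω => (X ω, Y ω)) inferInstance⟧
      =ᵐ[P] fun ω => 1 - Real.exp (-∑' κ, (Y ω κ).1 * (Y ω κ).2.1 i * (Y ω κ).2.2 j) := by
  refine (condDistrib_ae_eq_condExp (h.measurable_nodes.prodMk h.measurable_communities)
    h.measurable_edges (measurableSet_hasEdge i j)).symm.trans ?_
  filter_upwards [h.ae_condDistrib_edges, h.ae_summable hc hγ₀ he hf i j] with ω hω hs
  rw [hω, edgeLaw_real_hasEdge _ _ _ hs.1 hs.2]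

/-- Localising to an arbitrary node event `B` keeps enough information to recover the conditional
expectation given the nodes, while `B = univ` gives the total mean. -/
lemma measure_hasEdge_le (h : IsGraphGammaProcess P ν c γ₀ e f X Y Z) (hc : 0 < c) (hγ₀ : 0 < γ₀)
    (he : 0 < e) (hf : 0 < f) (i j : ℕ) {B : Set (Nodes D)} (hB : MeasurableSet B) :
    P (X ⁻¹' B ∩ Z ⁻¹' {z | HasEdge z i j})
      ≤ ∫⁻ x in B, ENNReal.ofReal (γ₀ / (c * e * f)) *
        (ENNReal.ofReal (x i).1 * ENNReal.ofReal (x j).2.2) ∂(P.map X) := by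
  have hm := h.measurable_nodes.prodMk h.measurable_communities
  have hrate : Measurable fun q : Nodes D × Communities => edgeRate i j q.2 :=
    (measurable_edgeRate i j).comp measurable_snd
  -- The edge kernel conditions on the pair `(X, Y)`, so the node event is rewritten as an event of
  -- the pair.
  have hpre : X ⁻¹' B = (fun ω => (X ω, Y ω)) ⁻¹' (B ×ˢ univ) := by
    ext ω
    simp
  calc P (X ⁻¹' B ∩ Z ⁻¹' {z | HasEdge z i j})
      = ∫⁻ ω in X ⁻¹' B, condDistrib Z (fun ω => (X ω, Y ω)) P (X ω, Y ω)
          {z | HasEdge z i j} ∂P := by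
        rw [hpre, setLIntegral_preimage_condDistrib hm h.measurable_edges.aemeasurable
          (measurableSet_hasEdge i j) (hB.prod MeasurableSet.univ)]
    _ ≤ ∫⁻ ω in X ⁻¹' B, edgeRate i j (Y ω) ∂P := by
        refine lintegral_mono_ae (ae_restrict_of_ae ?_)
        filter_upwards [h.ae_condDistrib_edges] with ω hω
        rw [hω]
        exact edgeLaw_hasEdge_le _ _ _
    _ = ∫⁻ q in B ×ˢ univ, edgeRate i j q.2 ∂(P.map fun ω => (X ω, Y ω)) := by
        rw [hpre, setLIntegral_map (hB.prod MeasurableSet.univ)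
          hrate hm]
    _ = ∫⁻ x in B, ∫⁻ y, edgeRate i j y ∂(condDistrib Y X P x) ∂(P.map X) := by
        rw [← compProd_map_condDistrib h.measurable_communities.aemeasurable,
          Measure.setLIntegral_compProd hrate hB
            MeasurableSet.univ]
        simp
    _ = _ := by
        refine lintegral_congr_ae (ae_restrict_of_ae ?_)
        filter_upwards [h.communities_law] with x hx
        exact lintegral_edgeRate hc hγ₀ he hf hx i j

lemma setLIntegral_edgeCount_le (h : IsGraphGammaProcess P ν c γ₀ e f X Y Z) (hc : 0 < c)
    (hγ₀ : 0 < γ₀) (he : 0 < e) (hf : 0 < f) {B : Set (Nodes D)} (hB : MeasurableSet B) :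
    ∫⁻ ω in X ⁻¹' B, edgeCount (Z ω) ∂P
      ≤ ∫⁻ x in B, ENNReal.ofReal (γ₀ / (c * e * f)) * totalWeight x * totalMark x ∂(P.map X) := by
  have hmeas (i j : ℕ) : Measurable fun ω => {z | HasEdge z i j}.indicator (1 : EdgeArray → ℝ≥0∞)
      (Z ω) := (measurable_one.indicator (measurableSet_hasEdge i j)).comp h.measurable_edges
  calc ∫⁻ ω in X ⁻¹' B, edgeCount (Z ω) ∂P
      = ∑' i, ∑' j, P (X ⁻¹' B ∩ Z ⁻¹' {z | HasEdge z i j}) := by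
        simp_rw [edgeCount_eq_tsum_indicator]
        rw [lintegral_tsum fun i => (Measurable.tsum fun j => hmeas i j).aemeasurable]
        refine tsum_congr fun i => ?_
        rw [lintegral_tsum fun j => (hmeas i j).aemeasurable]
        refine tsum_congr fun j => ?_
        have hE := h.measurable_edges (measurableSet_hasEdge i j)
        rw [inter_comm, ← Measure.restrict_apply hE, ← lintegral_indicator_one hE]
        rfl
    _ ≤ ∑' i, ∑' j, ∫⁻ x in B, ENNReal.ofReal (γ₀ / (c * e * f)) *
        (ENNReal.ofReal (x i).1 * ENNReal.ofReal (x j).2.2) ∂(P.map X) :=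
        ENNReal.tsum_le_tsum fun i => ENNReal.tsum_le_tsum fun j =>
          h.measure_hasEdge_le hc hγ₀ he hf i j hB
    _ = _ := by
        simp_rw [totalWeight, totalMark, mul_assoc, ← ENNReal.tsum_mul_right,
          ← ENNReal.tsum_mul_left]
        rw [lintegral_tsum fun i => by fun_prop]
        refine tsum_congr fun i => ?_
        rw [lintegral_tsum fun j => by fun_prop]

/-- Both sides are measurable for the σ-algebra generated by `X`, so on the trimmed measure it is
enough to compare their integrals over the sets `X ⁻¹' B`. -/
lemma condLExp_edgeCount_le (h : IsGraphGammaProcess P ν c γ₀ e f X Y Z) (hc : 0 < c)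
    (hγ₀ : 0 < γ₀) (he : 0 < e) (hf : 0 < f) :
    P⁻[fun ω => edgeCount (Z ω) | MeasurableSpace.comap X inferInstance]
      ≤ᵐ[P] fun ω => ENNReal.ofReal (γ₀ / (c * e * f)) * totalWeight (X ω) * totalMark (X ω) := by
  have hle := h.measurable_nodes.comap_le
  have hbound : Measurable fun x : Nodes D =>
      ENNReal.ofReal (γ₀ / (c * e * f)) * totalWeight x * totalMark x :=
    (measurable_totalWeight.const_mul _).mul measurable_totalMark
  refine ae_le_of_ae_le_trim (hm := hle) ?_
  refine ae_le_of_forall_setLIntegral_le_of_sigmaFinite (measurable_condLExp _ _ _) ?_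
  rintro _ ⟨B, hB, rfl⟩ _
  rw [setLIntegral_condLExp_trim hle _ _ ⟨B, hB, rfl⟩,
    setLIntegral_trim hle (f := fun ω => ENNReal.ofReal (γ₀ / (c * e * f)) * totalWeight (X ω)
      * totalMark (X ω)) (hbound.comp (comap_measurable X)) ⟨B, hB, rfl⟩]
  refine (h.setLIntegral_edgeCount_le hc hγ₀ he hf hB).trans_eq ?_
  exact setLIntegral_map hB hbound h.measurable_nodes

lemma lintegral_edgeCount_lt_top {cρ cτ γτ : ℝ} {G₀ : Measure D} [IsFiniteMeasure G₀]
    (h : IsGraphGammaProcess P ν c γ₀ e f X Y Z) (hν : IsMarkedGammaLevy cρ G₀ cτ γτ ν)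
    (hcρ : 0 < cρ) (hcτ : 0 < cτ) (hc : 0 < c) (hγ₀ : 0 < γ₀) (he : 0 < e) (hf : 0 < f) :
    ∫⁻ ω, edgeCount (Z ω) ∂P < ∞ := by
  have := Measure.isProbabilityMeasure_map (μ := P) h.measurable_nodes.aemeasurable
  have hle := h.setLIntegral_edgeCount_le hc hγ₀ he hf MeasurableSet.univ
  have hm : Measurable fun x : Nodes D => totalWeight x * totalMark x :=
    measurable_totalWeight.mul measurable_totalMark
  simp only [preimage_univ, Measure.restrict_univ, mul_assoc (ENNReal.ofReal _)] at hle
  rw [lintegral_const_mul _ hm] at hle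
  exact hle.trans_lt (ENNReal.mul_lt_top ENNReal.ofReal_lt_top
    (lintegral_totalWeight_mul_totalMark_lt_top hν hcρ hcτ h.nodes_law))

end IsGraphGammaProcess

end GraphGamma

theorem lemma2 {Ω D : Type*} [MeasurableSpace Ω] [MeasurableSpace D]
    (P : Measure Ω) [IsProbabilityMeasure P]
    (cρ cτ γτ c γ₀ e f : ℝ) (hcρ : 0 < cρ) (hcτ : 0 < cτ) (hγτ : 0 < γτ)
    (hc : 0 < c) (hγ₀ : 0 < γ₀) (he : 0 < e) (hf : 0 < f)
    (G₀ : Measure D) [IsFiniteMeasure G₀]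
    (ν : Measure (ℝ × D × ℝ)) (hν : GraphGamma.IsMarkedGammaLevy cρ G₀ cτ γτ ν)
    (X : Ω → GraphGamma.Nodes D) (Y : Ω → GraphGamma.Communities) (Z : Ω → GraphGamma.EdgeArray)
    (hGGP : GraphGamma.IsGraphGammaProcess P ν c γ₀ e f X Y Z) :
    -- the edge probabilities of the graph, given the nodes and communities
    (∀ i j : ℕ,
      (∀ᵐ ω ∂P, Summable fun κ => (Y ω κ).1 * (Y ω κ).2.1 i * (Y ω κ).2.2 j) ∧
      P⟦{ω | GraphGamma.HasEdge (Z ω) i j} |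
          MeasurableSpace.comap (fun ω => (X ω, Y ω)) inferInstance⟧
        =ᵐ[P] fun ω => 1 - Real.exp (-∑' κ, (Y ω κ).1 * (Y ω κ).2.1 i * (Y ω κ).2.2 j)) ∧
    -- the number of edges is finite
    (∀ᵐ ω ∂P, GraphGamma.edgeCount (Z ω) < ∞) ∧
    -- the number of nodes with nonzero degree is finite
    (∀ᵐ ω ∂P,
      {i | ∃ j, GraphGamma.HasEdge (Z ω) i j ∨ GraphGamma.HasEdge (Z ω) j i}.Finite) ∧
    -- the expected number of edges given the nodes
    (∀ᵐ ω ∂P, GraphGamma.totalWeight (X ω) < ∞ ∧ GraphGamma.totalMark (X ω) < ∞) ∧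
    P⁻[fun ω => GraphGamma.edgeCount (Z ω) | MeasurableSpace.comap X inferInstance]
      ≤ᵐ[P] (fun ω => ENNReal.ofReal (γ₀ / (c * e * f)) *
        GraphGamma.totalWeight (X ω) * GraphGamma.totalMark (X ω)) ∧
    -- the expected number of edges is finite
    ∫⁻ ω, GraphGamma.edgeCount (Z ω) ∂P < ∞ := by
  have := Measure.isProbabilityMeasure_map (μ := P) hGGP.measurable_nodes.aemeasurable
  have hint := hGGP.lintegral_edgeCount_lt_top hν hcρ hcτ hc hγ₀ he hf
  have hfin : ∀ᵐ ω ∂P, GraphGamma.edgeCount (Z ω) < ∞ :=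
    ae_lt_top (GraphGamma.measurable_edgeCount.comp hGGP.measurable_edges) hint.ne
  refine ⟨fun i j => ⟨(hGGP.ae_summable hc hγ₀ he hf i j).mono fun ω h => h.2,
    hGGP.condExp_hasEdge hc hγ₀ he hf i j⟩, hfin,
    hfin.mono fun ω h => GraphGamma.finite_nodes_of_edgeCount_lt_top h, ?_,
    hGGP.condLExp_edgeCount_le hc hγ₀ he hf, hint⟩
  exact ae_of_ae_map hGGP.measurable_nodes.aemeasurable
    (GraphGamma.ae_total_lt_top hν hcρ hcτ hGGP.nodes_law)
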